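/- Let $N\ge 1$ be an integer, let $0<h<H$ be real numbers and put $r=h/H$. Let $T_1^1,\dots,T_1^N$ and $L^1,\dots,L^N$ be jointly independent random variables with each $T_1^k$ uniform on $[0,H]$ and each $L^k$ uniform on $[0,h]$, and let $T_2^k=T_1^k+L^k$, so that the relative time windows are the random intervals $[T_1^k,T_2^k]$, $k=1,\dots,N$. Adaptive time discretization turns a sequence of windows into a finite set $\mathcal S$ of closed intervals (time buckets) as follows. Start with $\mathcal S=\{[T_1^1,T_2^1]\}$. For $k=2,\dots,N$ in turn, let $I=[T_1^k,T_2^k]$, let $[p_1,q_1],\dots,[p_m,q_m]$ be the current buckets in ascending order, and refine $\mathcal S$ by $I$: (i) every bucket $B$ for which both $B\cap I$ and $B\setminus I$ are non-empty is replaced by $B\cap I$ together with the one or two closed intervals that make up the closure of $B\setminus I$; (ii) each of the intersections of $I$ with $[q_j,p_{j+1}]$ $(1\le j<m)$, with $(-\infty,p_1]$ and with $[q_m,\infty)$ that is an interval of positive length is added as a new bucket. Let $\mathcal S$ be the resulting set of buckets for the $N$ random windows, and put $\beta=(N-1)r$ and $q=e(N+1)r/2$. Then $|\mathcal S|$ is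 integrable, $$N+\Big(\frac{\beta}{2}-\frac{\beta^2}{6}\Big)N\le\mathbb E[|\mathcal S|],$$ and, if $q<1$, $$\mathbb E[|\mathcal S|]\le N+\frac{qe}{2(1-q)}\,N .$$ -/

import Mathlib

open MeasureTheory ProbabilityTheory

/-- A time bucket (or a relative time window), given by its end points:
the pair `B` stands for the closed interval `[B.1, B.2]`. -/
abbrev TimeBucket : Type := ℝ × ℝ

namespace TimeBucket

/-- The closed interval represented by a bucket. -/
def toSet (B : TimeBucket) : Set ℝ := Set.Icc B.1 B.2

/-- A proper interval is one of positive length. -/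
def Proper (B : TimeBucket) : Prop := B.1 < B.2

/-- The end points of `B ∩ I`. -/
noncomputable def inter (B I : TimeBucket) : TimeBucket := (max B.1 I.1, min B.2 I.2)

open Classical in
/-- The intervals that make up the closure of `B \ I` when `B` meets `I`: the part of `B` to the
left of `I` and the part of `B` to the right of `I`, as far as they are present. -/
noncomputable def outside (B I : TimeBucket) : Finset TimeBucket :=
  (if B.1 < I.1 then {(B.1, I.1)} else ∅) ∪ (if I.2 < B.2 then {(I.2, B.2)} else ∅)

open Classical in
/-- What becomes of a bucket `B` when it is refined by the window `I`: if both `B ∩ I` and `B \ I`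
are non-empty, then `B` is replaced by `B ∩ I` and by the closure of `B \ I`; otherwise `B` is
kept. An intersection that is a singleton gives a singleton bucket. -/
noncomputable def split (I B : TimeBucket) : Finset TimeBucket :=
  if (B.toSet ∩ I.toSet).Nonempty ∧ (B.toSet \ I.toSet).Nonempty then
    {B.inter I} ∪ B.outside I
  else {B}

/-- The ascending order of buckets (by left end point, ties by right end point). -/
def Before (B C : TimeBucket) : Prop := toLex B < toLex C

/-- `B` and `C` are consecutive in the ascending enumeration of `S`. -/
def Consecutive (S : Finset TimeBucket) (B C : TimeBucket) : Prop :=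
  B ∈ S ∧ C ∈ S ∧ B.Before C ∧ ∀ D ∈ S, ¬ (B.Before D ∧ D.Before C)

open Classical in
/-- The intersections of `I` with the gaps `[q_k, p_{k+1}]` between consecutive buckets. -/
noncomputable def gapPieces (S : Finset TimeBucket) (I : TimeBucket) : Finset TimeBucket :=
  ((S ×ˢ S).filter fun P => Consecutive S P.1 P.2).image
    fun P => inter (P.1.2, P.2.1) I

open Classical in
/-- The intersection of `I` with `[-∞, p_1]`, where `p_1` is the left end of the first bucket. -/
noncomputable def leftPieces (S : Finset TimeBucket) (I : TimeBucket) : Finset TimeBucket :=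
  (S.filter fun B => ∀ D ∈ S, ¬ D.Before B).image fun B => (I.1, min B.1 I.2)

open Classical in
/-- The intersection of `I` with `[q_m, ∞]`, where `q_m` is the right end of the last bucket. -/
noncomputable def rightPieces (S : Finset TimeBucket) (I : TimeBucket) : Finset TimeBucket :=
  (S.filter fun B => ∀ D ∈ S, ¬ B.Before D).image fun B => (max B.2 I.1, I.2)

open Classical in
/-- The procedure that refines a collection `S` of sorted buckets by a window `I`: every bucket
of `S` is split by `I`, and the parts of `I` in the gaps of `S`, to the left of `S` and to the
right of `S` are added when they are proper intervals. -/
noncomputable def refine (S : Finset TimeBucket) (I : TimeBucket) : Finset TimeBucket :=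
  S.biUnion (split I) ∪
    (gapPieces S I ∪ leftPieces S I ∪ rightPieces S I).filter Proper

/-- Adaptive time discretization: the first window is taken as the only bucket, then the
collection is refined by the remaining windows, one after the other. -/
noncomputable def adaptiveDiscretization : List TimeBucket → Finset TimeBucket
  | [] => ∅
  | I :: L => L.foldl refine {I}

end TimeBucket

/-! Almost surely the windows are proper and no two of them share an end point. Under this condition
the procedure has a description that does not depend on the order of the windows: its buckets are
the cells, that is, the intervals between consecutive end points that some window covers. This is an
invariant of refinement (`refine_cells`), since a new generic window only cuts old cells at its ends
and fills the uncovered stretches that it meets.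

A cell is determined by its right end (`card_cells`). The right end of a window always ends a cell;
its left end does so exactly when another window starts earlier and reaches it. Hence the number of
buckets is N plus the number of covered left ends, and its expectation is N plus a sum of covering
probabilities.

A given window covers the left end of another one with probability r/2 - r²/6. The union bound gives
at most (N-1)r/2 per left end, which is already below the claimed upper bound. For the lower bound,
the second Bonferroni inequality is used. Given the point to be covered, two windows cover it
independently, each with probability at most r/2, so each pair costs at most r²/4. -/

namespace TimeBucket

/-! ### Cells of a finite family of windows -/

/-- The end points of the windows in `W`. -/
noncomputable def endpoints (W : Finset TimeBucket) : Finset ℝ :=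
  W.image Prod.fst ∪ W.image Prod.snd

open Classical in
/-- The intervals between consecutive end points of `W` that are covered by a window of `W`. -/
noncomputable def cells (W : Finset TimeBucket) : Finset TimeBucket :=
  (endpoints W ×ˢ endpoints W).filter fun B =>
    B.1 < B.2 ∧ (∀ e ∈ endpoints W, e ≤ B.1 ∨ B.2 ≤ e) ∧ ∃ w ∈ W, w.1 ≤ B.1 ∧ B.2 ≤ w.2

theorem mem_cells {W : Finset TimeBucket} {B : TimeBucket} :
    B ∈ cells W ↔ B.1 ∈ endpoints W ∧ B.2 ∈ endpoints W ∧ B.1 < B.2 ∧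
      (∀ e ∈ endpoints W, e ≤ B.1 ∨ B.2 ≤ e) ∧ ∃ w ∈ W, w.1 ≤ B.1 ∧ B.2 ≤ w.2 := by
  simp [cells, and_assoc]

theorem mem_endpoints {W : Finset TimeBucket} {e : ℝ} :
    e ∈ endpoints W ↔ ∃ w ∈ W, w.1 = e ∨ w.2 = e := by
  simp only [endpoints, Finset.mem_union, Finset.mem_image]
  grind

theorem fst_mem_endpoints {W : Finset TimeBucket} {w : TimeBucket} (hw : w ∈ W) :
    w.1 ∈ endpoints W := mem_endpoints.2 ⟨w, hw, Or.inl rfl⟩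

theorem snd_mem_endpoints {W : Finset TimeBucket} {w : TimeBucket} (hw : w ∈ W) :
    w.2 ∈ endpoints W := mem_endpoints.2 ⟨w, hw, Or.inr rfl⟩

theorem endpoints_insert (W : Finset TimeBucket) (I : TimeBucket) (e : ℝ) :
    e ∈ endpoints (insert I W) ↔ e = I.1 ∨ e = I.2 ∨ e ∈ endpoints W := by
  simp only [mem_endpoints, Finset.mem_insert]
  grind

/-- The cell runs from `e` to the next end point, which comes no later than `w.2`, so `w` covers it.
-/
theorem exists_cell_fst_eq {W : Finset TimeBucket} {e : ℝ} (he : e ∈ endpoints W)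
    {w : TimeBucket} (hw : w ∈ W) (h1 : w.1 ≤ e) (h2 : e < w.2) :
    ∃ B ∈ cells W, B.1 = e := by
  obtain ⟨b, hb, hmin⟩ := Finset.exists_min_image ((endpoints W).filter (e < ·)) id
    ⟨w.2, by simpa using ⟨snd_mem_endpoints hw, h2⟩⟩
  simp only [Finset.mem_filter, id, and_imp] at hb hmin
  refine ⟨(e, b), mem_cells.2 ⟨he, hb.1, hb.2, fun x hx => ?_, w, hw, h1, ?_⟩, rfl⟩
  · exact (le_or_gt x e).imp_right (hmin x hx)
  · exact hmin _ (snd_mem_endpoints hw) h2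

theorem exists_cell_snd_eq {W : Finset TimeBucket} {e : ℝ} (he : e ∈ endpoints W)
    {w : TimeBucket} (hw : w ∈ W) (h1 : w.1 < e) (h2 : e ≤ w.2) :
    ∃ B ∈ cells W, B.2 = e := by
  obtain ⟨b, hb, hmax⟩ := Finset.exists_max_image ((endpoints W).filter (· < e)) id
    ⟨w.1, by simpa using ⟨fst_mem_endpoints hw, h1⟩⟩
  simp only [Finset.mem_filter, id, and_imp] at hb hmax
  refine ⟨(b, e), mem_cells.2 ⟨hb.1, he, hb.2, fun x hx => ?_, w, hw, ?_, h2⟩, rfl⟩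
  · exact (lt_or_ge x e).imp_left (hmax x hx)
  · exact hmax _ (fst_mem_endpoints hw) h1

theorem exists_cell_of_mem_endpoints {W : Finset TimeBucket} (hW : ∀ w ∈ W, w.Proper) {e : ℝ}
    (he : e ∈ endpoints W) : ∃ B ∈ cells W, B.1 = e ∨ B.2 = e := by
  obtain ⟨w, hw, rfl | rfl⟩ := mem_endpoints.1 he
  · obtain ⟨B, hB, h⟩ := exists_cell_fst_eq he hw le_rfl (hW w hw)
    exact ⟨B, hB, Or.inl h⟩
  · obtain ⟨B, hB, h⟩ := exists_cell_snd_eq he hw (hW w hw) le_rfl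
    exact ⟨B, hB, Or.inr h⟩

/-- Take the cell that starts at the last end point not exceeding `a`. It ends after `a`, hence not
before `b`, as no end point lies strictly between the two. -/
theorem exists_cell_covering {W : Finset TimeBucket} {a b : ℝ} (hab : a < b)
    (hE : ∀ e ∈ endpoints W, e ≤ a ∨ b ≤ e) {w : TimeBucket} (hw : w ∈ W)
    (h1 : w.1 ≤ a) (h2 : b ≤ w.2) : ∃ B ∈ cells W, B.1 ≤ a ∧ b ≤ B.2 := by
  obtain ⟨c, hc, hmax⟩ := Finset.exists_max_image ((endpoints W).filter (· ≤ a)) id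
    ⟨w.1, by simpa using ⟨fst_mem_endpoints hw, h1⟩⟩
  simp only [Finset.mem_filter, id, and_imp] at hc hmax
  obtain ⟨B, hB, rfl⟩ := exists_cell_fst_eq hc.1 hw (hmax _ (fst_mem_endpoints hw) h1)
    (by linarith [hc.2])
  refine ⟨B, hB, hc.2, ?_⟩
  obtain ⟨-, h, hlt, -⟩ := mem_cells.1 hB
  exact (hE _ h).resolve_left fun h' => (hmax _ h h').not_gt hlt

theorem cells_nonempty {W : Finset TimeBucket} (hW : ∀ w ∈ W, w.Proper) (hne : W.Nonempty) :
    (cells W).Nonempty := by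
  obtain ⟨w, hw⟩ := hne
  obtain ⟨B, hB, -⟩ := exists_cell_of_mem_endpoints hW (fst_mem_endpoints hw)
  exact ⟨B, hB⟩

theorem before_iff {B C : TimeBucket} : B.Before C ↔ B.1 < C.1 ∨ B.1 = C.1 ∧ B.2 < C.2 :=
  Prod.Lex.toLex_lt_toLex

theorem eq_or_separated_of_mem_cells {W : Finset TimeBucket} {B C : TimeBucket}
    (hB : B ∈ cells W) (hC : C ∈ cells W) : B = C ∨ B.2 ≤ C.1 ∨ C.2 ≤ B.1 := by
  obtain ⟨b1, b2, b3, b4, -⟩ := mem_cells.1 hB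
  obtain ⟨c1, c2, c3, c4, -⟩ := mem_cells.1 hC
  have := b4 _ c1
  have := b4 _ c2
  have := c4 _ b1
  have := c4 _ b2
  rw [Prod.ext_iff]
  grind

/-- Distinct cells do not overlap, so the lexicographic order on them is the geometric one. This
turns `Consecutive` into a statement about gaps. -/
theorem before_iff_of_mem_cells {W : Finset TimeBucket} {B C : TimeBucket}
    (hB : B ∈ cells W) (hC : C ∈ cells W) : B.Before C ↔ B.2 ≤ C.1 := by
  have hB' := (mem_cells.1 hB).2.2.1
  have hC' := (mem_cells.1 hC).2.2.1
  rw [before_iff]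
  rcases eq_or_separated_of_mem_cells hB hC with rfl | h | h
  · grind
  · grind
  · grind

/-! ### Splitting and gap filling as conditions on end points -/

theorem mem_split {I B C : TimeBucket} (hI : I.Proper) (hB : B.Proper) :
    C ∈ split I B ↔
      ((B.1 ≤ I.2 ∧ I.1 ≤ B.2 ∧ (B.1 < I.1 ∨ I.2 < B.2)) ∧
        (C = B.inter I ∨ (B.1 < I.1 ∧ C = (B.1, I.1)) ∨ (I.2 < B.2 ∧ C = (I.2, B.2)))) ∨
      (¬ (B.1 ≤ I.2 ∧ I.1 ≤ B.2 ∧ (B.1 < I.1 ∨ I.2 < B.2)) ∧ C = B) := by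
  unfold Proper at hI hB
  have h1 : (B.toSet ∩ I.toSet).Nonempty ↔ B.1 ≤ I.2 ∧ I.1 ≤ B.2 := by
    rw [toSet, toSet, Set.Icc_inter_Icc, Set.nonempty_Icc]
    simp only [sup_le_iff, le_inf_iff]
    grind
  have h2 : (B.toSet \ I.toSet).Nonempty ↔ B.1 < I.1 ∨ I.2 < B.2 := by
    rw [Set.sdiff_nonempty, toSet, toSet, Set.Icc_subset_Icc_iff hB.le]
    grind
  unfold split
  simp only [h1, h2, and_assoc]
  split_ifs with h
  · simp only [h, outside, Finset.mem_union, Finset.mem_singleton, not_true, false_and, or_false,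
      true_and]
    split_ifs with h3 h4 h4 <;> simp [h3, h4]
  · rw [Finset.mem_singleton]
    tauto

theorem mem_gapPieces {S : Finset TimeBucket} {I C : TimeBucket} :
    C ∈ gapPieces S I ↔ ∃ A B, Consecutive S A B ∧ C = (max A.2 I.1, min B.1 I.2) := by
  simp only [gapPieces, Finset.mem_image, Finset.mem_filter, Finset.mem_product, inter]
  constructor
  · rintro ⟨⟨A, B⟩, ⟨-, h⟩, rfl⟩
    exact ⟨A, B, h, rfl⟩
  · rintro ⟨A, B, h, rfl⟩
    exact ⟨(A, B), ⟨⟨h.1, h.2.1⟩, h⟩, rfl⟩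

theorem mem_leftPieces {S : Finset TimeBucket} {I C : TimeBucket} :
    C ∈ leftPieces S I ↔ ∃ B ∈ S, (∀ D ∈ S, ¬ D.Before B) ∧ C = (I.1, min B.1 I.2) := by
  simp only [leftPieces, Finset.mem_image, Finset.mem_filter]
  grind

theorem mem_rightPieces {S : Finset TimeBucket} {I C : TimeBucket} :
    C ∈ rightPieces S I ↔ ∃ B ∈ S, (∀ D ∈ S, ¬ B.Before D) ∧ C = (max B.2 I.1, I.2) := by
  simp only [rightPieces, Finset.mem_image, Finset.mem_filter]
  grind

theorem mem_refine {S : Finset TimeBucket} {I C : TimeBucket} :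
    C ∈ refine S I ↔ (∃ B ∈ S, C ∈ split I B) ∨
      (C ∈ gapPieces S I ∨ C ∈ leftPieces S I ∨ C ∈ rightPieces S I) ∧ C.Proper := by
  simp [refine]

/-! ### Refining cells by a generic window gives cells -/

/-- Two windows have no end point in common. -/
def Generic (I J : TimeBucket) : Prop := I.1 ≠ J.1 ∧ I.1 ≠ J.2 ∧ I.2 ≠ J.1 ∧ I.2 ≠ J.2

theorem mem_cells_insert {W : Finset TimeBucket} {I B : TimeBucket} :
    B ∈ cells (insert I W) ↔ (B.1 = I.1 ∨ B.1 = I.2 ∨ B.1 ∈ endpoints W) ∧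
      (B.2 = I.1 ∨ B.2 = I.2 ∨ B.2 ∈ endpoints W) ∧ B.1 < B.2 ∧
      (I.1 ≤ B.1 ∨ B.2 ≤ I.1) ∧ (I.2 ≤ B.1 ∨ B.2 ≤ I.2) ∧
      (∀ e ∈ endpoints W, e ≤ B.1 ∨ B.2 ≤ e) ∧
      ((I.1 ≤ B.1 ∧ B.2 ≤ I.2) ∨ ∃ w ∈ W, w.1 ≤ B.1 ∧ B.2 ≤ w.2) := by
  rw [mem_cells]
  simp only [endpoints_insert, Finset.mem_insert, exists_eq_or_imp, forall_eq_or_imp]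
  grind

/-- Distinct end points exclude that `B` and `I` meet in a single point, which would create a
degenerate bucket. -/
theorem bounds_of_mem_split {I B C : TimeBucket} (hI : I.Proper) (hB : B.Proper)
    (n1 : B.1 ≠ I.1) (n2 : B.1 ≠ I.2) (n3 : B.2 ≠ I.1) (n4 : B.2 ≠ I.2) (hC : C ∈ split I B) :
    (C.1 = I.1 ∨ C.1 = I.2 ∨ C.1 = B.1) ∧ (C.2 = I.1 ∨ C.2 = I.2 ∨ C.2 = B.2) ∧
      B.1 ≤ C.1 ∧ C.1 < C.2 ∧ C.2 ≤ B.2 ∧ (I.1 ≤ C.1 ∨ C.2 ≤ I.1) ∧ (I.2 ≤ C.1 ∨ C.2 ≤ I.2) := by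
  rw [mem_split hI hB] at hC
  obtain ⟨s, t⟩ := I
  obtain ⟨p, q⟩ := B
  simp only [Proper, inter] at *
  rcases hC with ⟨⟨c1, c2, c3⟩, rfl | ⟨c4, rfl⟩ | ⟨c4, rfl⟩⟩ | ⟨c1, rfl⟩
  · grind
  · grind
  · grind
  · grind

theorem split_subset_cells_insert {W : Finset TimeBucket} {I B C : TimeBucket} (hI : I.Proper)
    (h1 : I.1 ∉ endpoints W) (h2 : I.2 ∉ endpoints W) (hB : B ∈ cells W) (hC : C ∈ split I B) :
    C ∈ cells (insert I W) := by
  obtain ⟨b1, b2, b3, b4, w, hw, b5, b6⟩ := mem_cells.1 hB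
  obtain ⟨c1, c2, c3, c4, c5, c6, c7⟩ := bounds_of_mem_split hI b3 (fun h => h1 (h ▸ b1))
    (fun h => h2 (h ▸ b1)) (fun h => h1 (h ▸ b2)) (fun h => h2 (h ▸ b2)) hC
  refine mem_cells_insert.2 ⟨c1.imp_right (Or.imp_right fun h : C.1 = B.1 => by rwa [h]),
    c2.imp_right (Or.imp_right fun h : C.2 = B.2 => by rwa [h]), c4, c6, c7, fun e he => ?_,
    Or.inr ⟨w, hw, b5.trans c3, c5.trans b6⟩⟩
  exact (b4 e he).imp (fun h => h.trans c3) fun h => c5.trans h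

theorem gapPiece_mem_cells_insert {W : Finset TimeBucket} (hW : ∀ w ∈ W, w.Proper)
    {I A B : TimeBucket} (hAB : Consecutive (cells W) A B)
    (hp : Proper (max A.2 I.1, min B.1 I.2)) :
    (max A.2 I.1, min B.1 I.2) ∈ cells (insert I W) := by
  obtain ⟨hA, hB, -, hD⟩ := hAB
  have l2 := (mem_cells.1 hA).2.2.1
  have l3 := (mem_cells.1 hB).2.2.1
  -- Every end point bounds some cell, and an end point strictly inside the gap would force that
  -- cell to lie between the consecutive cells `A` and `B`.
  have key : ∀ e ∈ endpoints W, e ≤ A.2 ∨ B.1 ≤ e := by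
    intro e he
    obtain ⟨D, hDc, hDe⟩ := exists_cell_of_mem_endpoints hW he
    have h := hD D hDc
    have l1 := (mem_cells.1 hDc).2.2.1
    rw [before_iff_of_mem_cells hA hDc, before_iff_of_mem_cells hDc hB] at h
    rcases eq_or_separated_of_mem_cells hA hDc with rfl | e1 | e1
    · left; rcases hDe with h | h <;> linarith
    · rcases eq_or_separated_of_mem_cells hDc hB with rfl | e2 | e2
      · right; rcases hDe with h | h <;> linarith
      · exact absurd ⟨e1, e2⟩ h
      · right; rcases hDe with h | h <;> linarith
    · left; rcases hDe with h | h <;> linarith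
  refine mem_cells_insert.2 ⟨?_, ?_, hp, Or.inl (le_max_right _ _), Or.inr (min_le_right _ _),
    fun e he => (key e he).imp le_max_of_le_left min_le_of_left_le,
    Or.inl ⟨le_max_right _ _, min_le_right _ _⟩⟩
  · rcases max_choice A.2 I.1 with h | h <;> simp [h, (mem_cells.1 hA).2.1]
  · rcases min_choice B.1 I.2 with h | h <;> simp [h, (mem_cells.1 hB).1]

theorem leftPiece_mem_cells_insert {W : Finset TimeBucket} (hW : ∀ w ∈ W, w.Proper)
    {I B : TimeBucket} (hB : B ∈ cells W) (hD : ∀ D ∈ cells W, ¬ D.Before B)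
    (hp : Proper (I.1, min B.1 I.2)) : (I.1, min B.1 I.2) ∈ cells (insert I W) := by
  have key : ∀ e ∈ endpoints W, B.1 ≤ e := by
    intro e he
    obtain ⟨D, hDc, hDe⟩ := exists_cell_of_mem_endpoints hW he
    have h := hD D hDc
    have l1 := (mem_cells.1 hDc).2.2.1
    have l2 := (mem_cells.1 hB).2.2.1
    rw [before_iff_of_mem_cells hDc hB] at h
    rcases eq_or_separated_of_mem_cells hB hDc with rfl | e1 | e1
    · rcases hDe with h | h <;> linarith
    · rcases hDe with h | h <;> linarith
    · exact absurd e1 h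
  refine mem_cells_insert.2 ⟨Or.inl rfl, ?_, hp, Or.inl le_rfl, Or.inr (min_le_right _ _),
    fun e he => Or.inr (min_le_of_left_le (key e he)), Or.inl ⟨le_rfl, min_le_right _ _⟩⟩
  rcases min_choice B.1 I.2 with h | h <;> simp [h, (mem_cells.1 hB).1]

theorem rightPiece_mem_cells_insert {W : Finset TimeBucket} (hW : ∀ w ∈ W, w.Proper)
    {I B : TimeBucket} (hB : B ∈ cells W) (hD : ∀ D ∈ cells W, ¬ B.Before D)
    (hp : Proper (max B.2 I.1, I.2)) : (max B.2 I.1, I.2) ∈ cells (insert I W) := by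
  have key : ∀ e ∈ endpoints W, e ≤ B.2 := by
    intro e he
    obtain ⟨D, hDc, hDe⟩ := exists_cell_of_mem_endpoints hW he
    have h := hD D hDc
    have l1 := (mem_cells.1 hDc).2.2.1
    have l2 := (mem_cells.1 hB).2.2.1
    rw [before_iff_of_mem_cells hB hDc] at h
    rcases eq_or_separated_of_mem_cells hB hDc with rfl | e1 | e1
    · rcases hDe with h | h <;> linarith
    · exact absurd e1 h
    · rcases hDe with h | h <;> linarith
  refine mem_cells_insert.2 ⟨?_, Or.inr (Or.inl rfl), hp, Or.inl (le_max_right _ _),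
    Or.inr le_rfl, fun e he => Or.inl (le_max_of_le_left (key e he)),
    Or.inl ⟨le_max_right _ _, le_rfl⟩⟩
  rcases max_choice B.2 I.1 with h | h <;> simp [h, (mem_cells.1 hB).2.1]

theorem refine_cells_subset {W : Finset TimeBucket} (hW : ∀ w ∈ W, w.Proper) {I C : TimeBucket}
    (hI : I.Proper) (h1 : I.1 ∉ endpoints W) (h2 : I.2 ∉ endpoints W)
    (hC : C ∈ refine (cells W) I) : C ∈ cells (insert I W) := by
  rw [mem_refine, mem_gapPieces, mem_leftPieces, mem_rightPieces] at hC
  rcases hC with ⟨B, hB, hC⟩ | ⟨⟨A, B, hAB, rfl⟩ | ⟨B, hB, hD, rfl⟩ | ⟨B, hB, hD, rfl⟩, hp⟩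
  · exact split_subset_cells_insert hI h1 h2 hB hC
  · exact gapPiece_mem_cells_insert hW hAB hp
  · exact leftPiece_mem_cells_insert hW hB hD hp
  · exact rightPiece_mem_cells_insert hW hB hD hp

/-- A new cell covered by an old window lies in one old cell `B`. An end of `C` that is an old end
point is an end of `B`; otherwise it is an end of `I`. So `C` is one of the pieces of `B`. -/
theorem mem_refine_cells_of_covered {W : Finset TimeBucket} {I C : TimeBucket}
    (hI : I.Proper) (hC : C ∈ cells (insert I W)) {w : TimeBucket} (hw : w ∈ W)
    (hw1 : w.1 ≤ C.1) (hw2 : C.2 ≤ w.2) : C ∈ refine (cells W) I := by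
  obtain ⟨c1, c2, c3, c4, c5, c6, -⟩ := mem_cells_insert.1 hC
  obtain ⟨B, hB, hB1, hB2⟩ := exists_cell_covering c3 c6 hw hw1 hw2
  obtain ⟨b1, b2, b3, b4, -⟩ := mem_cells.1 hB
  refine mem_refine.2 (Or.inl ⟨B, hB, (mem_split hI b3).2 ?_⟩)
  have e1 : C.1 ∈ endpoints W → C.1 = B.1 := fun h => by
    have := b4 _ h
    grind
  have e2 : C.2 ∈ endpoints W → C.2 = B.2 := fun h => by
    have := b4 _ h
    grind
  unfold Proper at hI
  simp only [Prod.ext_iff, inter]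
  grind

/-- Such a cell is covered by `I` alone, so every old cell lies entirely to its left or entirely to
its right. The nearest old cells on the two sides exhibit it as a gap piece; if one side is empty,
it is a left or right piece. -/
theorem mem_refine_cells_of_not_covered {W : Finset TimeBucket} (hW : ∀ w ∈ W, w.Proper)
    (hne : W.Nonempty) {I C : TimeBucket} (hC : C ∈ cells (insert I W))
    (hnc : ∀ w ∈ W, ¬ (w.1 ≤ C.1 ∧ C.2 ≤ w.2)) :
    C ∈ refine (cells W) I := by
  obtain ⟨c1, c2, c3, c4, c5, c6, c7⟩ := mem_cells_insert.1 hC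
  have cI : I.1 ≤ C.1 ∧ C.2 ≤ I.2 := c7.resolve_right (by simpa using hnc)
  have sep : ∀ D ∈ cells W, D.2 ≤ C.1 ∨ C.2 ≤ D.1 := by
    intro D hD
    obtain ⟨d1, d2, d3, d4, w, hw, d5, d6⟩ := mem_cells.1 hD
    have := hnc w hw
    have := c6 _ d1
    have := c6 _ d2
    grind
  have fstE : C.1 ∈ endpoints W → ∃ D ∈ cells W, D.2 = C.1 := by
    intro h
    obtain ⟨D, hD, h'⟩ := exists_cell_of_mem_endpoints hW h
    have := sep D hD
    have := (mem_cells.1 hD).2.2.1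
    exact ⟨D, hD, by grind⟩
  have sndE : C.2 ∈ endpoints W → ∃ D ∈ cells W, D.1 = C.2 := by
    intro h
    obtain ⟨D, hD, h'⟩ := exists_cell_of_mem_endpoints hW h
    have := sep D hD
    have := (mem_cells.1 hD).2.2.1
    exact ⟨D, hD, by grind⟩
  refine mem_refine.2 (Or.inr ⟨?_, c3⟩)
  rw [mem_gapPieces, mem_leftPieces, mem_rightPieces]
  -- `A` is the last old cell to the left of `C`. If `C.1` is an old end point, a cell ends there,
  -- and maximality makes that cell equal to `A`.
  have left : (∃ D ∈ cells W, D.2 ≤ C.1) → ∃ A ∈ cells W, A.2 ≤ C.1 ∧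
      (∀ D ∈ cells W, D.2 ≤ C.1 → ¬ A.Before D) ∧ C.1 = max A.2 I.1 := by
    rintro ⟨D, hD, hDC⟩
    obtain ⟨A, hA, hmax⟩ := Finset.exists_max_image ((cells W).filter (·.2 ≤ C.1)) toLex
      ⟨D, by simp [hD, hDC]⟩
    simp only [Finset.mem_filter, and_imp] at hA hmax
    refine ⟨A, hA.1, hA.2, fun D hD h => (hmax D hD h).not_gt, ?_⟩
    rcases c1 with h | h | h
    · grind
    · grind
    · obtain ⟨D', hD', h'⟩ := fstE h
      have h3 := (hmax D' hD' h'.le).not_gt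
      change ¬ A.Before D' at h3
      have := (mem_cells.1 hD').2.2.1
      have := (mem_cells.1 hA.1).2.2.1
      have := eq_or_separated_of_mem_cells hA.1 hD'
      rw [before_iff_of_mem_cells hA.1 hD'] at h3
      grind
  have right : (∃ D ∈ cells W, C.2 ≤ D.1) → ∃ B ∈ cells W, C.2 ≤ B.1 ∧
      (∀ D ∈ cells W, C.2 ≤ D.1 → ¬ D.Before B) ∧ C.2 = min B.1 I.2 := by
    rintro ⟨D, hD, hDC⟩
    obtain ⟨B, hB, hmin⟩ := Finset.exists_min_image ((cells W).filter (C.2 ≤ ·.1)) toLex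
      ⟨D, by simp [hD, hDC]⟩
    simp only [Finset.mem_filter, and_imp] at hB hmin
    refine ⟨B, hB.1, hB.2, fun D hD h => (hmin D hD h).not_gt, ?_⟩
    rcases c2 with h | h | h
    · grind
    · grind
    · obtain ⟨D', hD', h'⟩ := sndE h
      have h3 := (hmin D' hD' h'.ge).not_gt
      change ¬ D'.Before B at h3
      have := (mem_cells.1 hD').2.2.1
      have := (mem_cells.1 hB.1).2.2.1
      have := eq_or_separated_of_mem_cells hB.1 hD'
      rw [before_iff_of_mem_cells hD' hB.1] at h3
      grind
  by_cases hl : ∃ D ∈ cells W, D.2 ≤ C.1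
  · obtain ⟨A, hA, hAC, hAmax, hA1⟩ := left hl
    by_cases hr : ∃ D ∈ cells W, C.2 ≤ D.1
    · obtain ⟨B, hB, hBC, hBmin, hB1⟩ := right hr
      refine Or.inl ⟨A, B, ⟨hA, hB, ?_, fun D hD h => ?_⟩, Prod.ext hA1 hB1⟩
      · rw [before_iff_of_mem_cells hA hB]
        linarith
      · exact (sep D hD).elim (fun h' => hAmax D hD h' h.1) fun h' => hBmin D hD h' h.2
    · have hr' : ∀ D ∈ cells W, D.2 ≤ C.1 := fun D hD =>
        (sep D hD).resolve_right fun h => hr ⟨D, hD, h⟩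
      refine Or.inr (Or.inr ⟨A, hA, fun D hD => hAmax D hD (hr' D hD), Prod.ext hA1 ?_⟩)
      rcases c2 with h | h | h
      · grind
      · exact h
      · obtain ⟨D, hD, h'⟩ := sndE h
        exact absurd ⟨D, hD, h'.ge⟩ hr
  · have hl' : ∀ D ∈ cells W, C.2 ≤ D.1 := fun D hD =>
      (sep D hD).resolve_left fun h => hl ⟨D, hD, h⟩
    obtain ⟨D, hD⟩ := cells_nonempty hW hne
    obtain ⟨B, hB, hBC, hBmin, hB1⟩ := right ⟨D, hD, hl' D hD⟩
    refine Or.inr (Or.inl ⟨B, hB, fun D hD => hBmin D hD (hl' D hD), Prod.ext ?_ hB1⟩)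
    rcases c1 with h | h | h
    · exact h
    · grind
    · obtain ⟨D, hD, h'⟩ := fstE h
      exact absurd ⟨D, hD, h'.le⟩ hl

theorem refine_cells {W : Finset TimeBucket} (hW : ∀ w ∈ W, w.Proper) (hne : W.Nonempty)
    {I : TimeBucket} (hI : I.Proper) (hgen : ∀ w ∈ W, Generic w I) :
    refine (cells W) I = cells (insert I W) := by
  have h1 : I.1 ∉ endpoints W := fun h => by
    obtain ⟨w, hw, h⟩ := mem_endpoints.1 h
    have := hgen w hw
    unfold Generic at this
    tauto
  have h2 : I.2 ∉ endpoints W := fun h => by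
    obtain ⟨w, hw, h⟩ := mem_endpoints.1 h
    have := hgen w hw
    unfold Generic at this
    tauto
  ext C
  refine ⟨refine_cells_subset hW hI h1 h2, fun hC => ?_⟩
  by_cases hcov : ∃ w ∈ W, w.1 ≤ C.1 ∧ C.2 ≤ w.2
  · obtain ⟨w, hw, hw1, hw2⟩ := hcov
    exact mem_refine_cells_of_covered hI hC hw hw1 hw2
  · exact mem_refine_cells_of_not_covered hW hne hC fun w hw h => hcov ⟨w, hw, h⟩

/-! ### The whole procedure and the number of its buckets -/

theorem cells_singleton {I : TimeBucket} (hI : I.Proper) : cells {I} = {I} := by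
  unfold Proper at hI
  ext B
  rw [mem_cells, Finset.mem_singleton, Prod.ext_iff]
  simp only [mem_endpoints, Finset.mem_singleton, exists_eq_left]
  constructor
  · grind
  · rintro ⟨h1, h2⟩
    rw [h1, h2]
    grind

theorem foldl_refine_cells (L : List TimeBucket) :
    ∀ W : Finset TimeBucket, (∀ w ∈ W, w.Proper) → W.Nonempty → (∀ I ∈ L, I.Proper) →
      (∀ w ∈ W, ∀ I ∈ L, Generic w I) → L.Pairwise Generic →
      L.foldl refine (cells W) = cells (L.toFinset ∪ W) := by
  induction L with
  | nil => simp
  | cons I L ih =>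
    intro W hW hne hL hgen hpw
    rw [List.pairwise_cons] at hpw
    rw [List.foldl_cons, refine_cells hW hne (hL I (by simp)) fun w hw => hgen w hw I (by simp),
      ih _ ?_ (by simp) (fun J hJ => hL J (by simp [hJ])) ?_ hpw.2]
    · congr 1
      ext
      simp
    · simp only [Finset.mem_insert, forall_eq_or_imp]
      exact ⟨hL I (by simp), hW⟩
    · simp only [Finset.mem_insert, forall_eq_or_imp]
      exact ⟨hpw.1, fun w hw J hJ => hgen w hw J (by simp [hJ])⟩

theorem adaptiveDiscretization_eq_cells {L : List TimeBucket} (hL : ∀ I ∈ L, I.Proper)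
    (hpw : L.Pairwise Generic) : adaptiveDiscretization L = cells L.toFinset := by
  cases L with
  | nil => simp [adaptiveDiscretization, cells, endpoints]
  | cons I L =>
    rw [List.pairwise_cons] at hpw
    have hI := hL I (by simp)
    rw [adaptiveDiscretization, ← cells_singleton hI,
      foldl_refine_cells L _ (by simpa using hI) (by simp) (fun J hJ => hL J (by simp [hJ]))
        (by simpa using hpw.1) hpw.2]
    congr 1
    ext
    simp

open Classical in
-- Cells do not overlap, so a cell is determined by its right end; an end point is such a right end
-- exactly when some window covers a stretch just before it.
theorem card_cells (W : Finset TimeBucket) :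
    (cells W).card = ((endpoints W).filter fun e => ∃ w ∈ W, w.1 < e ∧ e ≤ w.2).card := by
  refine Finset.card_bij (fun B _ => B.2) (fun B hB => ?_) (fun B hB C hC h => ?_) fun e he => ?_
  · obtain ⟨-, h2, h3, -, w, hw, h4, h5⟩ := mem_cells.1 hB
    exact Finset.mem_filter.2 ⟨h2, w, hw, by linarith, h5⟩
  · have := (mem_cells.1 hB).2.2.1
    have := (mem_cells.1 hC).2.2.1
    rcases eq_or_separated_of_mem_cells hB hC with h' | h' | h'
    · exact h'
    · grind
    · grind
  · obtain ⟨he, w, hw, h1, h2⟩ := Finset.mem_filter.1 he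
    obtain ⟨B, hB, h⟩ := exists_cell_snd_eq he hw h1 h2
    exact ⟨B, hB, h⟩

open Classical in
/-- For windows in general position, the number of buckets exceeds the number of windows by the
number of windows whose left end point is covered by another window. -/
theorem card_adaptiveDiscretization_ofFn {N : ℕ} (s t : Fin N → ℝ) (hst : ∀ k, s k < t k)
    (hgen : ∀ j k, j ≠ k → Generic (s j, t j) (s k, t k)) :
    (adaptiveDiscretization (List.ofFn fun k => (s k, t k))).card =
      N + (Finset.univ.filter fun k => ∃ j, s j < s k ∧ s k ≤ t j).card := by
  have hs : Function.Injective s := fun j k h => by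
    by_contra hjk
    exact (hgen j k hjk).1 h
  have ht : Function.Injective t := fun j k h => by
    by_contra hjk
    exact (hgen j k hjk).2.2.2 h
  rw [adaptiveDiscretization_eq_cells, card_cells]
  -- A right end `t k` counts because window `k` itself covers the stretch before it; a left end
  -- counts only if another window does. Genericity keeps the two kinds disjoint.
  · have : ((endpoints (List.ofFn fun k => (s k, t k)).toFinset).filter fun e =>
        ∃ w ∈ (List.ofFn fun k => (s k, t k)).toFinset, w.1 < e ∧ e ≤ w.2) =
        Finset.univ.image t ∪
          (Finset.univ.filter fun k => ∃ j, s j < s k ∧ s k ≤ t j).image s := by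
      ext e
      simp only [Finset.mem_filter, mem_endpoints, List.mem_toFinset, List.mem_ofFn,
        Finset.mem_union, Finset.mem_image, Finset.mem_univ, true_and, exists_exists_eq_and]
      constructor
      · rintro ⟨⟨k, rfl | rfl⟩, h⟩
        · exact Or.inr ⟨k, h, rfl⟩
        · exact Or.inl ⟨k, rfl⟩
      · rintro (⟨k, rfl⟩ | ⟨k, h, rfl⟩)
        · exact ⟨⟨k, Or.inr rfl⟩, k, hst k, le_rfl⟩
        · exact ⟨⟨k, Or.inl rfl⟩, h⟩
    rw [this, Finset.card_union_of_disjoint, Finset.card_image_of_injective _ ht,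
      Finset.card_image_of_injective _ hs, Finset.card_univ, Fintype.card_fin]
    rw [Finset.disjoint_left]
    simp only [Finset.mem_image, Finset.mem_univ, true_and]
    rintro _ ⟨j, rfl⟩ ⟨k, -, h⟩
    rcases eq_or_ne k j with rfl | hkj
    · exact (hst k).ne h
    · exact (hgen k j hkj).2.1 h
  · simp only [List.mem_ofFn]
    rintro _ ⟨k, rfl⟩
    exact hst k
  · rw [List.pairwise_ofFn]
    exact fun j k h => hgen j k h.ne

end TimeBucket

namespace TimeBucket

/-! ### Independence, coincidences and a Bonferroni bound -/

section Independence

variable {Ω : Type*} [MeasurableSpace Ω] {μ : Measure Ω}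

theorem indepFun_of_notMem {ι : Type*} {X : ι → Ω → ℝ} (hX : iIndepFun X μ)
    (hm : ∀ i, AEMeasurable (X i) μ) {i : ι} {T : Finset ι} (hi : i ∉ T) :
    IndepFun (X i) (fun ω (j : T) => X j ω) μ :=
  (hX.indepFun_finset₀ {i} T (by simpa using hi) hm).comp
    (φ := fun v : ({i} : Finset ι) → ℝ => v ⟨i, by simp⟩) (ψ := id)
    (measurable_pi_apply _) measurable_id

/-- The joint law is a product, and each section of the diagonal at a fixed value of `Y` is a single
point, null for the law of `X`. -/
theorem ae_ne_of_indepFun [IsFiniteMeasure μ] {X Y : Ω → ℝ} (hXY : IndepFun X Y μ)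
    (hX : AEMeasurable X μ) (hY : AEMeasurable Y μ) (hac : μ.map X ≪ volume) :
    ∀ᵐ ω ∂μ, X ω ≠ Y ω := by
  have hD : MeasurableSet {p : ℝ × ℝ | p.1 = p.2} :=
    measurableSet_eq_fun measurable_fst measurable_snd
  have h0 : (μ.map Y).prod (μ.map X) {p : ℝ × ℝ | p.1 = p.2} = 0 := by
    rw [Measure.measure_prod_null hD]
    refine Filter.Eventually.of_forall fun y => hac ?_
    have : (Prod.mk y ⁻¹' {p : ℝ × ℝ | p.1 = p.2}) = {y} := by
      ext x
      simp [eq_comm]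
    rw [this]
    simp
  rw [← (indepFun_iff_map_prod_eq_prod_map_map hY hX).1 hXY.symm,
    Measure.map_apply_of_aemeasurable (hY.prodMk hX) hD] at h0
  rw [ae_iff]
  convert h0 using 2
  ext ω
  simp [eq_comm]

theorem ae_ne_of_iIndepFun [IsFiniteMeasure μ] {ι : Type*} [Fintype ι] [DecidableEq ι]
    {X : ι → Ω → ℝ} (hX : iIndepFun X μ) (hm : ∀ i, AEMeasurable (X i) μ) (i : ι)
    (hac : μ.map (X i) ≪ volume) {g : ({j // j ∈ Finset.univ.erase i} → ℝ) → ℝ}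
    (hg : Measurable g) : ∀ᵐ ω ∂μ, X i ω ≠ g fun j => X j ω :=
  ae_ne_of_indepFun ((indepFun_of_notMem hX hm (Finset.notMem_erase i _)).comp measurable_id hg)
    (hm i) (hg.comp_aemeasurable (aemeasurable_pi_lambda _ fun j => hm j)) hac

theorem map_triple_eq_prod [IsFiniteMeasure μ] {ι : Type*} [DecidableEq ι] {X : ι → Ω → ℝ}
    (hX : iIndepFun X μ) (hm : ∀ i, AEMeasurable (X i) μ) {a b c : ι} (hab : a ≠ b) (hac : a ≠ c)
    (hbc : b ≠ c) :
    μ.map (fun ω => (X a ω, (X b ω, X c ω))) =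
      (μ.map (X a)).prod ((μ.map (X b)).prod (μ.map (X c))) := by
  rw [← (indepFun_iff_map_prod_eq_prod_map_map (hm b) (hm c)).1 (hX.indepFun hbc)]
  exact (indepFun_iff_map_prod_eq_prod_map_map (hm a) ((hm b).prodMk (hm c))).1
    (hX.indepFun_prodMk₀ hm b c a hab.symm hac.symm).symm

/-- The nesting is that of one point to be covered, followed by two windows given as start and
length. -/
theorem map_quintuple_eq_prod [IsFiniteMeasure μ] {ι : Type*} [DecidableEq ι] {X : ι → Ω → ℝ}
    (hX : iIndepFun X μ) (hm : ∀ i, AEMeasurable (X i) μ) {a b c d e : ι}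
    (hab : a ≠ b) (hac : a ≠ c) (had : a ≠ d) (hae : a ≠ e) (hbc : b ≠ c) (hbd : b ≠ d)
    (hbe : b ≠ e) (hcd : c ≠ d) (hce : c ≠ e) (hde : d ≠ e) :
    μ.map (fun ω => (X a ω, ((X b ω, X c ω), (X d ω, X e ω)))) =
      (μ.map (X a)).prod (((μ.map (X b)).prod (μ.map (X c))).prod
        ((μ.map (X d)).prod (μ.map (X e)))) := by
  have hbc' := (hm b).prodMk (hm c)
  have hde' := (hm d).prodMk (hm e)
  rw [← (indepFun_iff_map_prod_eq_prod_map_map (hm b) (hm c)).1 (hX.indepFun hbc),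
    ← (indepFun_iff_map_prod_eq_prod_map_map (hm d) (hm e)).1 (hX.indepFun hde),
    ← (indepFun_iff_map_prod_eq_prod_map_map hbc' hde').1
      (hX.indepFun_prodMk_prodMk₀ hm b c d e hbd hbe hcd hce)]
  refine (indepFun_iff_map_prod_eq_prod_map_map (hm a) (hbc'.prodMk hde')).1 ?_
  exact (indepFun_of_notMem hX hm (i := a) (T := {b, c, d, e}) (by simp [*])).comp measurable_id
    (ψ := fun v : ({b, c, d, e} : Finset ι) → ℝ => ((v ⟨b, by simp⟩, v ⟨c, by simp⟩), (v ⟨d, by simp⟩, v ⟨e, by simp⟩)))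
    (by fun_prop)

/-- A lower bound of Bonferroni type for the measure of a union of events, in terms of bounds for
the events and for their pairwise intersections. -/
theorem le_measureReal_biUnion [IsFiniteMeasure μ] {ι : Type*} [DecidableEq ι] (s : Finset ι)
    (A : ι → Set Ω) (hA : ∀ i, NullMeasurableSet (A i) μ) {a b : ℝ}
    (ha : ∀ i ∈ s, a ≤ μ.real (A i))
    (hb : ∀ i ∈ s, ∀ j ∈ s, i ≠ j → μ.real (A i ∩ A j) ≤ b) :
    s.card * a - s.card * (s.card - 1) / 2 * b ≤ μ.real (⋃ i ∈ s, A i) := by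
  induction s using Finset.induction_on with
  | empty => simp
  | insert i s hi ih =>
    have ih := ih (fun j hj => ha j (by simp [hj]))
      fun j hj k hk => hb j (by simp [hj]) k (by simp [hk])
    have h1 : μ.real (A i ∩ ⋃ j ∈ s, A j) ≤ s.card * b := by
      rw [Set.inter_iUnion₂, ← nsmul_eq_mul]
      refine (measureReal_biUnion_finset_le _ _).trans (Finset.sum_le_card_nsmul _ _ _ fun j hj => ?_)
      exact hb i (by simp) j (by simp [hj]) fun h => hi (h ▸ hj)
    -- Adding one event to `s.card` others loses at most `s.card * b`; these losses add up to `b`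
    -- times the number of pairs.
    have h2 := measureReal_union_add_inter₀ (μ := μ) (s := A i) (t := ⋃ j ∈ s, A j)
      (NullMeasurableSet.biUnion s.countable_toSet fun j _ => hA j) (measure_ne_top _ _)
      (measure_ne_top _ _)
    have h3 := ha i (by simp)
    rw [Finset.set_biUnion_insert, Finset.card_insert_of_notMem hi]
    push_cast
    linarith

end Independence

/-! ### Probability that a random window covers a point -/

section Uniform

theorem isProbabilityMeasure_cond_Icc {c : ℝ} (hc : 0 < c) :
    IsProbabilityMeasure (cond volume (Set.Icc 0 c)) :=
  cond_isProbabilityMeasure_of_finite (by simp [hc]) (by simp)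

theorem lintegral_cond_Icc {c : ℝ} (hc : 0 < c) {f : ℝ → ℝ} (hf : Continuous f)
    (h0 : ∀ x ∈ Set.Icc 0 c, 0 ≤ f x) :
    ∫⁻ x, ENNReal.ofReal (f x) ∂(cond volume (Set.Icc 0 c)) =
      ENNReal.ofReal (c⁻¹ * ∫ x in 0..c, f x) := by
  rw [ProbabilityTheory.cond, lintegral_smul_measure, ← ofReal_integral_eq_lintegral_ofReal, Real.volume_Icc,
    intervalIntegral.integral_of_le hc.le, integral_Icc_eq_integral_Ioc, sub_zero, smul_eq_mul,
    ENNReal.ofReal_mul (by positivity), ENNReal.ofReal_inv_of_pos hc]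
  · exact hf.continuousOn.integrableOn_Icc
  · exact (ae_restrict_iff' measurableSet_Icc).2 (Filter.Eventually.of_forall h0)

theorem ae_cond_Icc {c : ℝ} {p : ℝ → Prop} (h : ∀ x ∈ Set.Icc 0 c, p x) :
    ∀ᵐ x ∂(cond volume (Set.Icc 0 c)), p x := by
  filter_upwards [ae_cond_mem (μ := volume) (measurableSet_Icc (a := (0 : ℝ)) (b := c))] with x hx
  exact h x hx

theorem cond_Icc_Ico_le {c : ℝ} (hc : 0 < c) (x l : ℝ) :
    cond volume (Set.Icc 0 c) (Set.Ico (x - l) x) ≤ ENNReal.ofReal (l / c) := by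
  rw [cond_apply measurableSet_Icc, Real.volume_Icc, sub_zero, div_eq_inv_mul,
    ENNReal.ofReal_mul (by positivity), ENNReal.ofReal_inv_of_pos hc]
  gcongr
  refine (measure_mono Set.inter_subset_right).trans ?_
  simp

/-- A window of length `l` covers `x` when it starts in `[x - l, x)`; the minimum accounts for the
part of this interval cut off at 0. -/
theorem cond_Icc_Ico {c x l : ℝ} (hc : 0 < c) (hx : x ∈ Set.Icc 0 c) :
    cond volume (Set.Icc 0 c) (Set.Ico (x - l) x) = ENNReal.ofReal (min l x / c) := by
  have h : Set.Icc 0 c ∩ Set.Ico (x - l) x = Set.Ico (max 0 (x - l)) x := by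
    ext y
    simp only [Set.mem_inter_iff, Set.mem_Icc, Set.mem_Ico, max_le_iff] at *
    grind
  rw [cond_apply measurableSet_Icc, Real.volume_Icc, sub_zero, div_eq_inv_mul,
    ENNReal.ofReal_mul (by positivity), ENNReal.ofReal_inv_of_pos hc, h,
    Real.volume_Ico]
  congr 2
  rcases le_total l x with h | h
  · rw [max_eq_right (by linarith), min_eq_left h]; ring
  · rw [max_eq_left (by linarith), min_eq_right h]; ring

/-- The law of a window, given by its left end point and its length. -/
noncomputable def windowLaw (h H : ℝ) : Measure (ℝ × ℝ) :=
  (cond volume (Set.Icc 0 H)).prod (cond volume (Set.Icc 0 h))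

/-- The windows, given by left end point and length, that cover `x` and start before `x`. -/
def coverSet (x : ℝ) : Set (ℝ × ℝ) := {p | p.1 < x ∧ x ≤ p.1 + p.2}

theorem measurableSet_setOf_mem_coverSet {α : Type*} [MeasurableSpace α] {f : α → ℝ}
    {g : α → ℝ × ℝ} (hf : Measurable f) (hg : Measurable g) :
    MeasurableSet {a | g a ∈ coverSet (f a)} :=
  (measurableSet_lt (by fun_prop) hf).inter (measurableSet_le hf (by fun_prop))

theorem measurableSet_coverSet (x : ℝ) : MeasurableSet (coverSet x) :=
  measurableSet_setOf_mem_coverSet measurable_const measurable_id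

theorem windowLaw_coverSet {h H : ℝ} (x : ℝ) :
    windowLaw h H (coverSet x) =
      ∫⁻ l, cond volume (Set.Icc 0 H) (Set.Ico (x - l) x) ∂(cond volume (Set.Icc 0 h)) := by
  rw [windowLaw, Measure.prod_apply_symm (measurableSet_coverSet x)]
  congr! 3 with l
  ext s
  simp only [coverSet, Set.mem_preimage, Set.mem_ofPred_eq, Set.mem_Ico]
  grind

/-- Ignoring the cut at 0 leaves the mean length h/2 divided by H. The bound is uniform in `x`, as
the estimate for pairs of windows requires. -/
theorem windowLaw_coverSet_le {h H : ℝ} (hh : 0 < h) (hH : 0 < H) (x : ℝ) :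
    windowLaw h H (coverSet x) ≤ ENNReal.ofReal (h / H / 2) := by
  rw [windowLaw_coverSet]
  refine (lintegral_mono fun l => cond_Icc_Ico_le hH x l).trans ?_
  rw [lintegral_cond_Icc hh (by fun_prop) fun l hl => div_nonneg hl.1 hH.le]
  apply ENNReal.ofReal_le_ofReal
  rw [intervalIntegral.integral_div, integral_id]
  apply le_of_eq
  field_simp
  ring

theorem integral_min_left {l H : ℝ} (h0 : 0 ≤ l) (hl : l ≤ H) :
    ∫ x in 0..H, min l x = l * H - l ^ 2 / 2 := by
  rw [← intervalIntegral.integral_add_adjacent_intervals (b := l)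
    (Continuous.intervalIntegrable (by fun_prop) _ _)
    (Continuous.intervalIntegrable (by fun_prop) _ _)]
  have h1 : ∫ x in 0..l, min l x = ∫ x in 0..l, x :=
    intervalIntegral.integral_congr fun x hx => by
      rw [Set.uIcc_of_le h0] at hx
      exact min_eq_right hx.2
  have h2 : ∫ x in l..H, min l x = ∫ x in l..H, l :=
    intervalIntegral.integral_congr fun x hx => by
      rw [Set.uIcc_of_le hl] at hx
      exact min_eq_left hx.1
  rw [h1, h2, integral_id, intervalIntegral.integral_const, smul_eq_mul]
  ring

/-- By Tonelli the point can be averaged first at fixed length, which gives (lH - l²/2)/H²;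
averaging over l in [0, h] then uses the means h/2 of l and h²/3 of l². -/
theorem lintegral_windowLaw_coverSet {h H : ℝ} (hh : 0 < h) (hH : h ≤ H) :
    ∫⁻ x, windowLaw h H (coverSet x) ∂(cond volume (Set.Icc 0 H)) =
      ENNReal.ofReal (h / H / 2 - (h / H) ^ 2 / 6) := by
  have hH0 : 0 < H := hh.trans_le hH
  have := isProbabilityMeasure_cond_Icc hh
  have := isProbabilityMeasure_cond_Icc hH0
  calc
    _ = ∫⁻ x, ∫⁻ l, ENNReal.ofReal (min l x / H) ∂(cond volume (Set.Icc 0 h))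
          ∂(cond volume (Set.Icc 0 H)) := by
      refine lintegral_congr_ae (ae_cond_Icc fun x hx => ?_)
      simp only [windowLaw_coverSet]
      exact lintegral_congr fun l => cond_Icc_Ico hH0 hx
    _ = ∫⁻ l, ∫⁻ x, ENNReal.ofReal (min l x / H) ∂(cond volume (Set.Icc 0 H))
          ∂(cond volume (Set.Icc 0 h)) := by
      refine lintegral_lintegral_swap (Measurable.aemeasurable ?_)
      unfold Function.uncurry
      fun_prop
    _ = ∫⁻ l, ENNReal.ofReal (H⁻¹ * ((l * H - l ^ 2 / 2) / H)) ∂(cond volume (Set.Icc 0 h)) := by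
      refine lintegral_congr_ae (ae_cond_Icc fun l hl => ?_)
      dsimp only
      rw [lintegral_cond_Icc hH0 (by fun_prop) fun x hx => div_nonneg (le_min hl.1 hx.1) hH0.le,
        intervalIntegral.integral_div, integral_min_left hl.1 (hl.2.trans hH)]
    _ = ENNReal.ofReal (h⁻¹ * (H⁻¹ * ((h ^ 2 / 2 * H - h ^ 3 / 3 / 2) / H))) := by
      rw [lintegral_cond_Icc hh (by fun_prop)]
      · rw [intervalIntegral.integral_const_mul, intervalIntegral.integral_div,
          intervalIntegral.integral_sub, intervalIntegral.integral_mul_const, integral_id,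
          intervalIntegral.integral_div, integral_pow]
        · norm_num
        · exact Continuous.intervalIntegrable (by fun_prop) _ _
        · exact Continuous.intervalIntegrable (by fun_prop) _ _
      · rintro l ⟨h0, hl⟩
        have : 0 ≤ l * H - l ^ 2 / 2 := by nlinarith
        positivity
    _ = _ := by
      congr 1
      field_simp
      ring

end Uniform

end TimeBucket

namespace TimeBucket

/-! ### Covering events of the random windows and the expected number of buckets -/

section Windows

variable {Ω : Type*} {N : ℕ} {h H : ℝ} {T L : Fin N → Ω → ℝ}

/-- The event that the left end point of window `k` is covered by window `j`. -/
def coverEvent (T L : Fin N → Ω → ℝ) (k j : Fin N) : Set Ω :=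
  {ω | (T j ω, L j ω) ∈ coverSet (T k ω)}

/-- The event that the left end point of window `k` is covered by another window. -/
def coveredEvent (T L : Fin N → Ω → ℝ) (k : Fin N) : Set Ω :=
  ⋃ j ∈ Finset.univ.erase k, coverEvent T L k j

theorem mem_coveredEvent {k : Fin N} {ω : Ω} :
    ω ∈ coveredEvent T L k ↔ ∃ j, T j ω < T k ω ∧ T k ω ≤ T j ω + L j ω := by
  simp only [coveredEvent, coverEvent, coverSet, Set.mem_iUnion, Finset.mem_erase, Set.mem_ofPred_eq,
    Finset.mem_univ, and_true, exists_prop]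
  refine exists_congr fun j => and_iff_right_of_imp fun hj hjk => ?_
  exact (hjk ▸ hj.1).false

variable [MeasurableSpace Ω] {μ : Measure Ω}

theorem aemeasurable_of_isUniform_Icc {c : ℝ} (hc : 0 < c) {X : Ω → ℝ}
    (hX : pdf.IsUniform X (Set.Icc 0 c) μ volume) : AEMeasurable X μ :=
  hX.aemeasurable (by simp [hc]) (by simp)

theorem aemeasurable_sumElim (hh : 0 < h) (hH : h ≤ H)
    (hT : ∀ k, pdf.IsUniform (T k) (Set.Icc 0 H) μ volume)
    (hL : ∀ k, pdf.IsUniform (L k) (Set.Icc 0 h) μ volume) (i : Fin N ⊕ Fin N) :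
    AEMeasurable (Sum.elim T L i) μ := by
  rcases i with k | k
  · exact aemeasurable_of_isUniform_Icc (hh.trans_le hH) (hT k)
  · exact aemeasurable_of_isUniform_Icc hh (hL k)

theorem nullMeasurableSet_coverEvent (hT : ∀ k, AEMeasurable (T k) μ)
    (hL : ∀ k, AEMeasurable (L k) μ) (k j : Fin N) :
    NullMeasurableSet (coverEvent T L k j) μ :=
  ((hT k).prodMk ((hT j).prodMk (hL j))).nullMeasurable
    (measurableSet_setOf_mem_coverSet measurable_fst measurable_snd)

theorem nullMeasurableSet_coveredEvent (hT : ∀ k, AEMeasurable (T k) μ)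
    (hL : ∀ k, AEMeasurable (L k) μ) (k : Fin N) : NullMeasurableSet (coveredEvent T L k) μ :=
  NullMeasurableSet.biUnion (Finset.countable_toSet _) fun j _ =>
    nullMeasurableSet_coverEvent hT hL k j

theorem measure_preimage_coverSet {h H : ℝ} (hh : 0 < h) (hH : h ≤ H) {X Y Z : Ω → ℝ}
    (hX : AEMeasurable X μ) (hY : AEMeasurable Y μ) (hZ : AEMeasurable Z μ)
    (hlaw : μ.map (fun ω => (X ω, (Y ω, Z ω))) =
      (cond volume (Set.Icc 0 H)).prod (windowLaw h H)) :
    μ {ω | (Y ω, Z ω) ∈ coverSet (X ω)} = ENNReal.ofReal (h / H / 2 - (h / H) ^ 2 / 6) := by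
  have := isProbabilityMeasure_cond_Icc hh
  have := isProbabilityMeasure_cond_Icc (hh.trans_le hH)
  have : SFinite (windowLaw h H) := by unfold windowLaw; infer_instance
  have hD : MeasurableSet {p : ℝ × (ℝ × ℝ) | p.2 ∈ coverSet p.1} :=
    measurableSet_setOf_mem_coverSet measurable_fst measurable_snd
  have h1 := Measure.map_apply_of_aemeasurable (hX.prodMk (hY.prodMk hZ)) hD
  rw [hlaw, Measure.prod_apply hD] at h1
  rw [← lintegral_windowLaw_coverSet hh hH]
  exact h1.symm

/-- The two events are dependent through `X`, but for each fixed value of `X` the section is a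
product set, and both factors have measure at most r/2. -/
theorem measure_inter_preimage_coverSet_le {h H : ℝ} (hh : 0 < h) (hH : h ≤ H)
    {X Y Z Y' Z' : Ω → ℝ} (hX : AEMeasurable X μ) (hY : AEMeasurable Y μ) (hZ : AEMeasurable Z μ)
    (hY' : AEMeasurable Y' μ) (hZ' : AEMeasurable Z' μ)
    (hlaw : μ.map (fun ω => (X ω, ((Y ω, Z ω), (Y' ω, Z' ω)))) =
      (cond volume (Set.Icc 0 H)).prod ((windowLaw h H).prod (windowLaw h H))) :
    μ ({ω | (Y ω, Z ω) ∈ coverSet (X ω)} ∩ {ω | (Y' ω, Z' ω) ∈ coverSet (X ω)}) ≤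
      ENNReal.ofReal ((h / H / 2) ^ 2) := by
  have := isProbabilityMeasure_cond_Icc hh
  have hH0 := hh.trans_le hH
  have := isProbabilityMeasure_cond_Icc hH0
  have : SFinite (windowLaw h H) := by unfold windowLaw; infer_instance
  have hD : MeasurableSet ({p : ℝ × ((ℝ × ℝ) × (ℝ × ℝ)) | p.2.1 ∈ coverSet p.1} ∩
      {p : ℝ × ((ℝ × ℝ) × (ℝ × ℝ)) | p.2.2 ∈ coverSet p.1}) :=
    (measurableSet_setOf_mem_coverSet (by fun_prop) (by fun_prop)).inter
      (measurableSet_setOf_mem_coverSet (by fun_prop) (by fun_prop))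
  have h1 := Measure.map_apply_of_aemeasurable
    (hX.prodMk ((hY.prodMk hZ).prodMk (hY'.prodMk hZ'))) hD
  rw [hlaw, Measure.prod_apply hD] at h1
  refine h1.symm.le.trans ?_
  calc
    _ ≤ ∫⁻ _, ENNReal.ofReal ((h / H / 2) ^ 2) ∂(cond volume (Set.Icc 0 H)) := by
      refine lintegral_mono fun x => ?_
      change ((windowLaw h H).prod (windowLaw h H)) (coverSet x ×ˢ coverSet x) ≤ _
      rw [Measure.prod_prod, sq, ENNReal.ofReal_mul (by positivity)]
      exact mul_le_mul' (windowLaw_coverSet_le hh hH0 x) (windowLaw_coverSet_le hh hH0 x)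
    _ = _ := by simp

variable [IsProbabilityMeasure μ]

theorem ae_generic_windows (hh : 0 < h) (hH : h ≤ H)
    (hT : ∀ k, pdf.IsUniform (T k) (Set.Icc 0 H) μ volume)
    (hL : ∀ k, pdf.IsUniform (L k) (Set.Icc 0 h) μ volume)
    (hind : iIndepFun (Sum.elim T L) μ) :
    ∀ᵐ ω ∂μ, (∀ k, 0 < L k ω) ∧ ∀ j k, j ≠ k →
      Generic (T j ω, T j ω + L j ω) (T k ω, T k ω + L k ω) := by
  have hm := aemeasurable_sumElim hh hH hT hL
  have hpos : ∀ k, ∀ᵐ ω ∂μ, 0 < L k ω := by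
    intro k
    have hmk := hm (Sum.inr k)
    have h1 : ∀ᵐ x ∂(μ.map (L k)), 0 < x := by
      have h2 : ∀ᵐ x ∂(μ.map (L k)), x ∈ Set.Icc 0 h := by
        rw [hL k]
        exact ae_cond_mem measurableSet_Icc
      have h3 : ∀ᵐ x ∂(μ.map (L k)), x ≠ 0 :=
        (hL k).absolutelyContinuous.ae_le (Measure.ae_ne volume 0)
      filter_upwards [h2, h3] with x hx hx0
      exact lt_of_le_of_ne hx.1 hx0.symm
    exact ae_of_ae_map hmk h1
  -- Each coincidence is solved for `T j`, so that it equates `T j` with a function of the other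
  -- variables; the third comes from equality of the two right ends. The remaining one, a right end
  -- of `j` at the left end of `k`, is the second with the indices exchanged.
  have hgen : ∀ j k, j ≠ k → ∀ᵐ ω ∂μ, T j ω ≠ T k ω ∧ T j ω ≠ T k ω + L k ω ∧
      T j ω ≠ T k ω + L k ω - L j ω := by
    intro j k hjk
    have hac : μ.map (Sum.elim T L (Sum.inl j)) ≪ volume := (hT j).absolutelyContinuous
    have mk : (Sum.inl k : Fin N ⊕ Fin N) ∈ Finset.univ.erase (Sum.inl j) := by
      simpa using hjk.symm
    have mr : ∀ i, (Sum.inr i : Fin N ⊕ Fin N) ∈ Finset.univ.erase (Sum.inl j) := by simp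
    have h1 := ae_ne_of_iIndepFun hind hm (Sum.inl j) hac
      (g := fun v => v ⟨_, mk⟩) (by fun_prop)
    have h2 := ae_ne_of_iIndepFun hind hm (Sum.inl j) hac
      (g := fun v => v ⟨_, mk⟩ + v ⟨_, mr k⟩) (by fun_prop)
    have h3 := ae_ne_of_iIndepFun hind hm (Sum.inl j) hac
      (g := fun v => v ⟨_, mk⟩ + v ⟨_, mr k⟩ - v ⟨_, mr j⟩) (by fun_prop)
    filter_upwards [h1, h2, h3] with ω h1 h2 h3
    exact ⟨h1, h2, h3⟩
  have hgen' : ∀ᵐ ω ∂μ, ∀ j k, j ≠ k → T j ω ≠ T k ω ∧ T j ω ≠ T k ω + L k ω ∧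
      T j ω ≠ T k ω + L k ω - L j ω := by
    simp only [ae_all_iff]
    exact hgen
  filter_upwards [ae_all_iff.2 hpos, hgen'] with ω h1 h2
  refine ⟨h1, fun j k hjk => ⟨(h2 j k hjk).1, (h2 j k hjk).2.1, (h2 k j hjk.symm).2.1.symm, ?_⟩⟩
  have := (h2 j k hjk).2.2
  contrapose! this
  dsimp only at this
  linarith

theorem measureReal_coverEvent (hh : 0 < h) (hH : h ≤ H)
    (hT : ∀ k, pdf.IsUniform (T k) (Set.Icc 0 H) μ volume)
    (hL : ∀ k, pdf.IsUniform (L k) (Set.Icc 0 h) μ volume)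
    (hind : iIndepFun (Sum.elim T L) μ) {k j : Fin N} (hjk : j ≠ k) :
    μ.real (coverEvent T L k j) = h / H / 2 - (h / H) ^ 2 / 6 := by
  have hm := aemeasurable_sumElim hh hH hT hL
  have hlaw := map_triple_eq_prod hind hm (a := Sum.inl k) (b := Sum.inl j) (c := Sum.inr j)
    (by simpa using hjk.symm) (by simp) (by simp)
  have hT' : ∀ k, μ.map (T k) = cond volume (Set.Icc 0 H) := hT
  have hL' : ∀ k, μ.map (L k) = cond volume (Set.Icc 0 h) := hL
  simp only [Sum.elim_inl, Sum.elim_inr, hT', hL'] at hlaw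
  have hA : μ (coverEvent T L k j) = ENNReal.ofReal (h / H / 2 - (h / H) ^ 2 / 6) :=
    measure_preimage_coverSet hh hH (hm (Sum.inl k)) (hm (Sum.inl j)) (hm (Sum.inr j)) hlaw
  rw [measureReal_def, hA, ENNReal.toReal_ofReal]
  have h1 : h / H ≤ 1 := (div_le_one (hh.trans_le hH)).2 hH
  have h0 : 0 < h / H := div_pos hh (hh.trans_le hH)
  nlinarith

theorem measureReal_coverEvent_inter_le (hh : 0 < h) (hH : h ≤ H)
    (hT : ∀ k, pdf.IsUniform (T k) (Set.Icc 0 H) μ volume)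
    (hL : ∀ k, pdf.IsUniform (L k) (Set.Icc 0 h) μ volume)
    (hind : iIndepFun (Sum.elim T L) μ) {k i j : Fin N} (hik : i ≠ k) (hjk : j ≠ k)
    (hij : i ≠ j) :
    μ.real (coverEvent T L k i ∩ coverEvent T L k j) ≤ (h / H / 2) ^ 2 := by
  have hm := aemeasurable_sumElim hh hH hT hL
  have hlaw := map_quintuple_eq_prod hind hm (a := Sum.inl k) (b := Sum.inl i) (c := Sum.inr i)
    (d := Sum.inl j) (e := Sum.inr j) (by simpa using hik.symm) (by simp)
    (by simpa using hjk.symm) (by simp) (by simp) (by simpa using hij) (by simp) (by simp)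
    (by simpa using hij) (by simp)
  have hT' : ∀ k, μ.map (T k) = cond volume (Set.Icc 0 H) := hT
  have hL' : ∀ k, μ.map (L k) = cond volume (Set.Icc 0 h) := hL
  simp only [Sum.elim_inl, Sum.elim_inr, hT', hL'] at hlaw
  exact ENNReal.toReal_le_of_le_ofReal (by positivity) (measure_inter_preimage_coverSet_le hh hH
    (hm (Sum.inl k)) (hm (Sum.inl i)) (hm (Sum.inr i)) (hm (Sum.inl j)) (hm (Sum.inr j)) hlaw)

theorem card_univ_erase_fin (k : Fin N) : ((Finset.univ.erase k).card : ℝ) = N - 1 := by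
  rw [Finset.card_erase_of_mem (Finset.mem_univ k), Finset.card_univ, Fintype.card_fin,
    Nat.cast_sub k.pos, Nat.cast_one]

theorem measureReal_coveredEvent_le (hh : 0 < h) (hH : h ≤ H)
    (hT : ∀ k, pdf.IsUniform (T k) (Set.Icc 0 H) μ volume)
    (hL : ∀ k, pdf.IsUniform (L k) (Set.Icc 0 h) μ volume)
    (hind : iIndepFun (Sum.elim T L) μ) (k : Fin N) :
    μ.real (coveredEvent T L k) ≤ (N - 1) * (h / H / 2) := by
  rw [← card_univ_erase_fin k, ← nsmul_eq_mul]
  refine (measureReal_biUnion_finset_le _ _).trans (Finset.sum_le_card_nsmul _ _ _ fun j hj => ?_)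
  rw [measureReal_coverEvent hh hH hT hL hind (Finset.ne_of_mem_erase hj)]
  linarith [sq_nonneg (h / H)]

theorem le_measureReal_coveredEvent (hh : 0 < h) (hH : h ≤ H)
    (hT : ∀ k, pdf.IsUniform (T k) (Set.Icc 0 H) μ volume)
    (hL : ∀ k, pdf.IsUniform (L k) (Set.Icc 0 h) μ volume)
    (hind : iIndepFun (Sum.elim T L) μ) (k : Fin N) :
    (N - 1) * (h / H) / 2 - ((N - 1) * (h / H)) ^ 2 / 6 ≤ μ.real (coveredEvent T L k) := by
  have hm := aemeasurable_sumElim hh hH hT hL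
  have key := le_measureReal_biUnion (Finset.univ.erase k) (coverEvent T L k)
    (nullMeasurableSet_coverEvent (fun k => hm (Sum.inl k)) (fun k => hm (Sum.inr k)) k)
    (fun j hj => (measureReal_coverEvent hh hH hT hL hind (Finset.ne_of_mem_erase hj)).ge)
    (fun i hi j hj hij => measureReal_coverEvent_inter_le hh hH hT hL hind
      (Finset.ne_of_mem_erase hi) (Finset.ne_of_mem_erase hj) hij)
  refine le_trans ?_ key
  -- With n = N - 1, Bonferroni subtracts nr²/6 + n(n-1)r²/8 from nr/2, whereas the claim subtracts
  -- n²r²/6. The difference is n(n-1)r²/24, nonnegative because n is a natural number.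
  have hn : 0 ≤ ((Finset.univ.erase k).card : ℝ) * ((Finset.univ.erase k).card - 1) := by
    rcases Nat.eq_zero_or_pos (Finset.univ.erase k).card with h | h
    · simp [h]
    · have : (1 : ℝ) ≤ (Finset.univ.erase k).card := by exact_mod_cast h
      exact mul_nonneg (by positivity) (by linarith)
  rw [← card_univ_erase_fin k]
  nlinarith [mul_nonneg hn (sq_nonneg (h / H))]

/-- The equality holds on the almost sure event of general position; integrability and the
expectation are read off from the bounded right-hand side. -/
theorem card_adaptiveDiscretization_ae_eq (hh : 0 < h) (hH : h ≤ H)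
    (hT : ∀ k, pdf.IsUniform (T k) (Set.Icc 0 H) μ volume)
    (hL : ∀ k, pdf.IsUniform (L k) (Set.Icc 0 h) μ volume)
    (hind : iIndepFun (Sum.elim T L) μ) :
    (fun ω => ((adaptiveDiscretization
        (List.ofFn fun k => (T k ω, T k ω + L k ω))).card : ℝ)) =ᵐ[μ]
      fun ω => N + ∑ k, (coveredEvent T L k).indicator (fun _ => (1 : ℝ)) ω := by
  classical
  filter_upwards [ae_generic_windows hh hH hT hL hind] with ω hω
  rw [card_adaptiveDiscretization_ofFn (fun k => T k ω) (fun k => T k ω + L k ω)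
    (fun k => lt_add_of_pos_right _ (hω.1 k)) hω.2]
  push_cast
  simp only [Set.indicator_apply, mem_coveredEvent, Finset.sum_boole]

theorem integrable_indicator_coveredEvent (hT : ∀ k, AEMeasurable (T k) μ)
    (hL : ∀ k, AEMeasurable (L k) μ) (k : Fin N) :
    Integrable ((coveredEvent T L k).indicator fun _ => (1 : ℝ)) μ :=
  (integrable_const 1).indicator₀ (nullMeasurableSet_coveredEvent hT hL k)

theorem integrable_card_adaptiveDiscretization (hh : 0 < h) (hH : h ≤ H)
    (hT : ∀ k, pdf.IsUniform (T k) (Set.Icc 0 H) μ volume)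
    (hL : ∀ k, pdf.IsUniform (L k) (Set.Icc 0 h) μ volume)
    (hind : iIndepFun (Sum.elim T L) μ) :
    Integrable (fun ω => ((adaptiveDiscretization
      (List.ofFn fun k => (T k ω, T k ω + L k ω))).card : ℝ)) μ := by
  have hm := aemeasurable_sumElim hh hH hT hL
  refine Integrable.congr ?_ (card_adaptiveDiscretization_ae_eq hh hH hT hL hind).symm
  exact (integrable_const _).add (integrable_finsetSum _ fun k _ =>
    integrable_indicator_coveredEvent (fun k => hm (Sum.inl k)) (fun k => hm (Sum.inr k)) k)

theorem integral_card_adaptiveDiscretization (hh : 0 < h) (hH : h ≤ H)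
    (hT : ∀ k, pdf.IsUniform (T k) (Set.Icc 0 H) μ volume)
    (hL : ∀ k, pdf.IsUniform (L k) (Set.Icc 0 h) μ volume)
    (hind : iIndepFun (Sum.elim T L) μ) :
    ∫ ω, ((adaptiveDiscretization
      (List.ofFn fun k => (T k ω, T k ω + L k ω))).card : ℝ) ∂μ =
      N + ∑ k, μ.real (coveredEvent T L k) := by
  have hm := aemeasurable_sumElim hh hH hT hL
  have hi : ∀ k, Integrable ((coveredEvent T L k).indicator fun _ => (1 : ℝ)) μ :=
    integrable_indicator_coveredEvent (fun k => hm (Sum.inl k)) (fun k => hm (Sum.inr k))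
  rw [integral_congr_ae (card_adaptiveDiscretization_ae_eq hh hH hT hL hind),
    integral_add (integrable_const _) (integrable_finsetSum _ fun k _ => hi k),
    integral_finsetSum _ fun k _ => hi k]
  congr 1
  · simp
  · refine Finset.sum_congr rfl fun k _ => ?_
    have hB : NullMeasurableSet (coveredEvent T L k) μ :=
      nullMeasurableSet_coveredEvent (fun k => hm (Sum.inl k)) (fun k => hm (Sum.inr k)) k
    rw [integral_indicator₀ hB]
    simp

end Windows

end TimeBucket

/-! ### The two bounds -/

theorem theorem1 {Ω : Type*} [MeasurableSpace Ω] (μ : Measure Ω) [IsProbabilityMeasure μ]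
    (N : ℕ) (h H r β q : ℝ) (hh : 0 < h) (hH : h < H)
    (hr : r = h / H) (hβ : β = ((N : ℝ) - 1) * r) (hq : q = Real.exp 1 * ((N : ℝ) + 1) * r / 2)
    (T₁ T₂ : Fin N → Ω → ℝ)
    (hT₁ : ∀ k, pdf.IsUniform (T₁ k) (Set.Icc 0 H) μ volume)
    (hlen : ∀ k, pdf.IsUniform (fun ω => T₂ k ω - T₁ k ω) (Set.Icc 0 h) μ volume)
    (hind : iIndepFun
      (fun i : Fin N ⊕ Fin N => Sum.elim T₁ (fun k ω => T₂ k ω - T₁ k ω) i) μ) :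
    Integrable (fun ω => ((TimeBucket.adaptiveDiscretization
        (List.ofFn fun k => (T₁ k ω, T₂ k ω))).card : ℝ)) μ ∧
    (N : ℝ) + (β / 2 - β ^ 2 / 6) * N ≤
      ∫ ω, ((TimeBucket.adaptiveDiscretization
        (List.ofFn fun k => (T₁ k ω, T₂ k ω))).card : ℝ) ∂μ ∧
    (q < 1 →
      ∫ ω, ((TimeBucket.adaptiveDiscretization
        (List.ofFn fun k => (T₁ k ω, T₂ k ω))).card : ℝ) ∂μ ≤
        (N : ℝ) + q * Real.exp 1 / (2 * (1 - q)) * N) := by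
  have hint := TimeBucket.integrable_card_adaptiveDiscretization hh hH.le hT₁ hlen hind
  have hval := TimeBucket.integral_card_adaptiveDiscretization hh hH.le hT₁ hlen hind
  simp only [add_sub_cancel] at hint hval
  refine ⟨hint, ?_, fun hq1 => ?_⟩
  · rw [hval, hβ, hr]
    have := Finset.card_nsmul_le_sum Finset.univ _ _ fun k _ =>
      TimeBucket.le_measureReal_coveredEvent hh hH.le hT₁ hlen hind k
    rw [Finset.card_univ, Fintype.card_fin, nsmul_eq_mul] at this
    linarith
  · rw [hval]
    have h1 := Finset.sum_le_card_nsmul Finset.univ _ _ fun k _ =>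
      TimeBucket.measureReal_coveredEvent_le hh hH.le hT₁ hlen hind k
    rw [Finset.card_univ, Fintype.card_fin, nsmul_eq_mul, ← hr] at h1
    have hr0 : 0 < r := hr ▸ div_pos hh (hh.trans hH)
    -- Only e ≥ 2 is needed: it gives (N+1)r ≤ q, and 2(1-q) ≤ 2 ≤ e gives q ≤ qe/(2(1-q)). The
    -- union bound (N-1)r/2 lies below the first term of this chain.
    have he : 2 ≤ Real.exp 1 := by linarith [Real.add_one_le_exp (1 : ℝ)]
    have hN : (0 : ℝ) ≤ N := N.cast_nonneg
    have hNr : 0 ≤ ((N : ℝ) + 1) * r := by positivity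
    have hqr : ((N : ℝ) + 1) * r ≤ q := by
      rw [hq]
      nlinarith
    have hq2 : q ≤ q * Real.exp 1 / (2 * (1 - q)) := by
      rw [le_div_iff₀ (by linarith)]
      have : 2 * (1 - q) ≤ Real.exp 1 := by linarith
      exact mul_le_mul_of_nonneg_left this (hNr.trans hqr)
    have h2 : ((N : ℝ) - 1) * (r / 2) ≤ q * Real.exp 1 / (2 * (1 - q)) := by
      nlinarith
    linarith [mul_le_mul_of_nonneg_left h2 hN]
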